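/- **Theorem (Leray type cohomology spectral sequence).** Let $\mathscr A$ be a complete abelian category with exact products. *Notation.* For a simplicial set $X$ let $\Delta/X$ be its simplex category: objects are the simplices of $X$, and morphisms $x\to x'$ are the morphisms $\theta$ of $\Delta$ with $x=X(\theta)(x')$. A map $f\colon X\to Y$ induces $\Delta/f\colon\Delta/X\to\Delta/Y$, $x\mapsto f(x)$. A Gabriel–Zisman natural system on $X$ is a functor $T\colon\Delta/X\to\mathscr A$. Its cohomology $H^n_{GZ}(X,T)$ is the $n$-th cohomology of the cochain complex $C^n_{GZ}(X,T)=\prod_{\sigma\in X_n}T(\sigma)$ with differential $\sum_{i=0}^{n+1}(-1)^i d^i$, where the component of $d^i$ at $\sigma\in X_{n+1}$ is the projection to $T(\sigma\circ\delta^i)$ followed by the morphism $T(\sigma\circ\delta^i)\to T(\sigma)$ induced by the coface map $\delta^i$. It is functorial: a map $\varphi\colon X'\to X$ and a natural transformation $\tau\colon T\circ\Delta/\varphi\to T'$ induce $H^n_{GZ}(X,T)\to H^n_{GZ}(X',T')$. Write $(\Delta/f)^*$ for precomposition with $\Delta/f$, and $(\Delta/f)_*=\mathrm{Ran}_{\Delta/f}$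 for right Kan extension along $\Delta/f$. A connected sequence of functors between abelian categories consists of additive functors $F^q$, $q\ge 0$, with connecting morphisms $F^q(C)\to F^{q+1}(A)$, natural in the short exact sequence $0\to A\to B\to C\to 0$, whose long sequences are complexes. It is universal if every natural transformation $F^0\to G^0$ to the degree $0$ part of a connected sequence $G$ extends uniquely to a morphism $F\to G$. The right satellites of a functor $F$ are the terms of a universal connected sequence with degree $0$ part $F$; they are unique up to unique isomorphism if they exist. *Claim.* For every map $f\colon X\to Y$ of simplicial sets the right satellites $R^q(\Delta/f)_*$, $q\ge 0$, of $(\Delta/f)_*$ exist, and for every Gabriel–Zisman natural system $T\colon\Delta/X\to\mathscr A$ there is a first quadrant cohomological spectral sequence $$E_2^{p,q}\cong H^p_{GZ}\bigl(Y,\,R^q(\Delta/f)_*(T)\bigr)\;\Longrightarrow\;H^{p+q}_{GZ}(X,T),$$ that is, $H^n=H^n_{GZ}(X,T)$ has a decreasing filtration $H^n=F^0\supseteq F^1\supseteq\dots\supseteq F^{n+1}=0$ with $F^p/F^{p+1}\cong E_\infty^{p,n-p}$ for $0\le p\le n$. The spectral sequence is natural in $f$ and $T$ in the following sense. A morphism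 $(f,T)\to(f',T')$ consists of maps $\varphi\colon X'\to X$ and $\psi\colon Y'\to Y$ with $f\varphi=\psi f'$ and a natural transformation $\tau\colon T\circ\Delta/\varphi\to T'$. Then the canonical base change transformation $(\Delta/\psi)^*(\Delta/f)_*\to(\Delta/f')_*(\Delta/\varphi)^*$ extends uniquely to a morphism of connected sequences $(\Delta/\psi)^*R^q(\Delta/f)_*\to R^q(\Delta/f')_*(\Delta/\varphi)^*$; the spectral sequence, the filtrations and the isomorphisms $F^p/F^{p+1}\cong E_\infty^{p,q}$ are functorial in $(f,T)$, the abutment carrying the maps $H^n_{GZ}(X,T)\to H^n_{GZ}(X',T')$ induced by $(\varphi,\tau)$; and the isomorphism for $E_2^{p,q}$ is natural with respect to the map $H^p_{GZ}(Y,R^q(\Delta/f)_*T)\to H^p_{GZ}(Y',R^q(\Delta/f')_*T')$ induced by $\psi$ and the composite $(\Delta/\psi)^*R^q(\Delta/f)_*T\to R^q(\Delta/f')_*(\Delta/\varphi)^*T\to R^q(\Delta/f')_*T'$. -/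

import Mathlib

open CategoryTheory CategoryTheory.Limits Opposite Simplicial

universe u v w

noncomputable section

/-! ### Connected sequences of functors and right satellites -/

namespace Homological

/-- A (covariant, nonnegatively graded) connected sequence of additive functors, also called a
cohomological `∂`-functor: additive functors `obj n` with connecting morphisms
`obj n S.X₃ ⟶ obj (n + 1) S.X₁`, natural in the short exact sequence `S`, such that the resulting
long sequences are complexes. -/
structure ConnectedSequence (C : Type*) [Category C] [Abelian C] (D : Type*) [Category D]
    [Abelian D] where
  obj (n : ℕ) : C ⥤ D
  additive (n : ℕ) : (obj n).Additive
  δ (n : ℕ) (S : ShortComplex C) (hS : S.ShortExact) : (obj n).obj S.X₃ ⟶ (obj (n + 1)).obj S.X₁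
  map_g_δ (n : ℕ) (S : ShortComplex C) (hS : S.ShortExact) : (obj n).map S.g ≫ δ n S hS = 0
  δ_map_f (n : ℕ) (S : ShortComplex C) (hS : S.ShortExact) :
    δ n S hS ≫ (obj (n + 1)).map S.f = 0
  δ_naturality (n : ℕ) {S S' : ShortComplex C} (hS : S.ShortExact) (hS' : S'.ShortExact)
    (a : S ⟶ S') : δ n S hS ≫ (obj (n + 1)).map a.τ₁ = (obj n).map a.τ₃ ≫ δ n S' hS'

namespace ConnectedSequence

variable {C C' D D' : Type*} [Category C] [Abelian C] [Category C'] [Abelian C']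
  [Category D] [Abelian D] [Category D'] [Abelian D']

/-- Morphisms of connected sequences. -/
@[ext]
structure Hom (F G : ConnectedSequence C D) where
  app (n : ℕ) : F.obj n ⟶ G.obj n
  comm (n : ℕ) (S : ShortComplex C) (hS : S.ShortExact) :
    F.δ n S hS ≫ (app (n + 1)).app S.X₁ = (app n).app S.X₃ ≫ G.δ n S hS

/-- A connected sequence `F` is universal if every natural transformation `F⁰ ⟶ G⁰` to the
degree zero part of a connected sequence `G` extends uniquely to a morphism `F ⟶ G`. -/
def IsUniversal (F : ConnectedSequence C D) : Prop :=
  ∀ (G : ConnectedSequence C D) (a : F.obj 0 ⟶ G.obj 0), ∃! b : Hom F G, b.app 0 = a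

/-- Precomposition of a connected sequence with an exact functor. -/
def precomp (L : C' ⥤ C) [L.Additive] [PreservesFiniteLimits L] [PreservesFiniteColimits L]
    (F : ConnectedSequence C D) : ConnectedSequence C' D where
  obj n := L ⋙ F.obj n
  additive n := by
    have := F.additive n
    infer_instance
  δ n S hS := F.δ n (S.map L) (hS.map_of_exact L)
  map_g_δ n S hS := F.map_g_δ n (S.map L) (hS.map_of_exact L)
  δ_map_f n S hS := F.δ_map_f n (S.map L) (hS.map_of_exact L)
  δ_naturality n _ _ hS hS' a :=
    F.δ_naturality n (hS.map_of_exact L) (hS'.map_of_exact L) (L.mapShortComplex.map a)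

/-- Postcomposition of a connected sequence with an additive functor. -/
def postcomp (F : ConnectedSequence C D) (L : D ⥤ D') [L.Additive] : ConnectedSequence C D' where
  obj n := F.obj n ⋙ L
  additive n := by
    have := F.additive n
    infer_instance
  δ n S hS := L.map (F.δ n S hS)
  map_g_δ n S hS := by simp [← L.map_comp, F.map_g_δ]
  δ_map_f n S hS := by simp [← L.map_comp, F.δ_map_f]
  δ_naturality n _ _ hS hS' a := by
    rw [Functor.comp_map, Functor.comp_map, ← L.map_comp, F.δ_naturality n hS hS' a, L.map_comp]

end ConnectedSequence

/-- The right satellites `S⁰F = F, S¹F, S²F, …` of a functor `F`: a universal connected sequence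
with degree zero part `F`. They are unique up to a unique isomorphism if they exist. -/
structure RightSatellites {C D : Type*} [Category C] [Abelian C] [Category D] [Abelian D]
    (F : C ⥤ D) where
  seq : ConnectedSequence C D
  zeroIso : seq.obj 0 ≅ F
  isUniversal : seq.IsUniversal

/-! ### Convergence of first quadrant spectral sequences -/

/-- For a first quadrant cohomological spectral sequence, the differentials into and out of the
entry `(p, q)` vanish on all pages `r` with `p < r` and `q + 1 < r`, so that `E_∞^{p,q}` is the
entry `(p, q)` of the page `p + q + 2`. -/
def pageInfty (A : Type v) [Category.{w} A] [Abelian A] (p q : ℕ) :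
    E₂CohomologicalSpectralSequenceNat A ⥤ A :=
  SpectralSequence.pageFunctor A _ 2 ((p : ℤ) + q + 2) (by lia) ⋙ HomologicalComplex.eval _ _ (p, q)

/-- Natural convergence `E₂^{p,q} ⇒ H^{p+q}` of a family of first quadrant spectral sequences `E`
depending functorially on `j : J`: a natural decreasing filtration
`H n = F⁰ ⊇ F¹ ⊇ ⋯ ⊇ Fⁿ ⊇ Fⁿ⁺¹ = 0` of `H n` together with natural isomorphisms
`Fᵖ / Fᵖ⁺¹ ≅ E_∞^{p,q}` for `p + q = n`, the latter given as short exact sequences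
`0 ⟶ Fᵖ⁺¹ ⟶ Fᵖ ⟶ E_∞^{p,q} ⟶ 0`. -/
structure Convergence {J : Type*} [Category J] {A : Type v} [Category.{w} A] [Abelian A]
    (E : J ⥤ E₂CohomologicalSpectralSequenceNat A) (H : ℕ → (J ⥤ A)) where
  fil (n p : ℕ) : J ⥤ A
  ι (n p : ℕ) : fil n p ⟶ H n
  mono_ι (n p : ℕ) (j : J) : Mono ((ι n p).app j)
  incl (n p : ℕ) : fil n (p + 1) ⟶ fil n p
  incl_ι (n p : ℕ) : incl n p ≫ ι n p = ι n (p + 1)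
  isIso_ι_zero (n : ℕ) (j : J) : IsIso ((ι n 0).app j)
  isZero_fil (n : ℕ) (j : J) : IsZero ((fil n (n + 1)).obj j)
  proj (p q : ℕ) : fil (p + q) p ⟶ E ⋙ pageInfty A p q
  incl_proj (p q : ℕ) (j : J) : (incl (p + q) p).app j ≫ (proj p q).app j = 0
  shortExact (p q : ℕ) (j : J) :
    (ShortComplex.mk ((incl (p + q) p).app j) ((proj p q).app j) (incl_proj p q j)).ShortExact

end Homological

namespace GabrielZisman

open Homological

/-! ### The simplex category of a simplicial set -/

/-- The simplex category `Δ/X`: objects are the simplices of `X`, morphisms `x ⟶ x'` are the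
morphisms `θ` of `Δ` with `x = X(θ)(x')`. -/
abbrev Simp (X : SSet.{u}) : Type u := X.Elementsᵒᵖ

/-- The functor `Δ/f : Δ/X ⥤ Δ/Y`, `x ↦ f x`. -/
abbrev simpMap {X Y : SSet.{u}} (f : X ⟶ Y) : Simp X ⥤ Simp Y :=
  (CategoryOfElements.map f).op

/-- The simplex `x ∈ X_n` as an object of `Δ/X`. -/
abbrev Simp.mk (X : SSet.{u}) {n : SimplexCategory} (x : X.obj (op n)) : Simp X :=
  op (X.elementsMk (op n) x)

/-- The morphism `X(θ)(x) ⟶ x` of `Δ/X` given by a morphism `θ` of `Δ`. -/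
abbrev Simp.homMk (X : SSet.{u}) {m n : SimplexCategory} (θ : m ⟶ n) (x : X.obj (op n)) :
    Simp.mk X (X.map θ.op x) ⟶ Simp.mk X x :=
  Quiver.Hom.op (CategoryOfElements.homMk (X.elementsMk (op n) x)
    (X.elementsMk (op m) (X.map θ.op x)) θ.op rfl)

variable (A : Type v) [Category.{w} A]

/-! ### Natural systems and their cohomology -/

/-- A Gabriel-Zisman natural system: a simplicial set `X` and a functor `T : Δ/X ⥤ A`. -/
structure NatSys where
  X : SSet.{u}
  T : Simp X ⥤ A

variable {A}

namespace NatSys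

/-- A morphism `(X, T) ⟶ (X', T')` is a simplicial map `φ : X' ⟶ X` together with a natural
transformation `T ∘ Δ/φ ⟶ T'`. -/
@[ext]
structure Hom (S S' : NatSys.{u} A) where
  φ : S'.X ⟶ S.X
  τ : simpMap φ ⋙ S.T ⟶ S'.T

instance : Category (NatSys.{u} A) where
  Hom := Hom
  id S := { φ := 𝟙 _, τ := 𝟙 S.T }
  comp {S S' S''} a b :=
    { φ := b.φ ≫ a.φ
      τ := (Functor.whiskerLeft (simpMap b.φ) a.τ :
        simpMap b.φ ⋙ simpMap a.φ ⋙ S.T ⟶ simpMap b.φ ⋙ S'.T) ≫ b.τ }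
  id_comp a := by
    refine Hom.ext (Category.comp_id a.φ) (heq_of_eq ?_)
    ext x
    exact Category.id_comp _
  comp_id a := by
    refine Hom.ext (Category.id_comp a.φ) (heq_of_eq ?_)
    ext x
    exact Category.comp_id _
  assoc a b c := by
    refine Hom.ext (Category.assoc c.φ b.φ a.φ).symm (heq_of_eq ?_)
    ext x
    exact Category.assoc _ _ _

lemma π_map_congr [HasProducts.{u} A] (S : NatSys.{u} A) {m : SimplexCategory}
    {x y : S.X.obj (op m)} (h : x = y) {z : Simp S.X} (a : Simp.mk S.X x ⟶ z)
    (b : Simp.mk S.X y ⟶ z) (hab : a.unop.val = b.unop.val) :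
    Pi.π (fun σ : S.X.obj (op m) ↦ S.T.obj (Simp.mk S.X σ)) x ≫ S.T.map a =
      Pi.π (fun σ : S.X.obj (op m) ↦ S.T.obj (Simp.mk S.X σ)) y ≫ S.T.map b := by
  subst h
  have : a = b := Quiver.Hom.unop_inj (Subtype.ext hab)
  rw [this]

/-- The cosimplicial object `[n] ↦ ∏ (σ : X_n), T σ`. A morphism `θ : [m] ⟶ [n]` induces the
morphism whose component at `σ ∈ X_n` is the projection to the factor `T (X(θ)(σ))` followed by
`T` of the morphism `X(θ)(σ) ⟶ σ` of `Δ/X`. -/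
def cosimplicial [HasProducts.{u} A] (S : NatSys.{u} A) : CosimplicialObject A where
  obj n := ∏ᶜ fun σ : S.X.obj (op n) ↦ S.T.obj (Simp.mk S.X σ)
  map {m n} θ := Pi.lift fun σ ↦
    Pi.π (fun σ : S.X.obj (op m) ↦ S.T.obj (Simp.mk S.X σ)) (S.X.map θ.op σ) ≫
      S.T.map (Simp.homMk S.X θ σ)
  map_id n := by
    refine Pi.hom_ext _ _ fun σ ↦ ?_
    rw [Pi.lift_π, Category.id_comp]
    refine (π_map_congr S (x := S.X.map (𝟙 n).op σ) (y := σ) (by simp)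
      (Simp.homMk S.X (𝟙 n) σ) (𝟙 (Simp.mk S.X σ)) rfl).trans ?_
    rw [S.T.map_id]
    exact Category.comp_id _
  map_comp {l m n} a b := by
    refine Pi.hom_ext _ _ fun σ ↦ ?_
    rw [Pi.lift_π, Category.assoc, Pi.lift_π, Pi.lift_π_assoc, Category.assoc, ← S.T.map_comp]
    exact π_map_congr S (by simp) _ _ rfl

/-- The component `T (φ σ) ⟶ T' σ` at a simplex `σ` of a morphism `(X, T) ⟶ (X', T')`. -/
def Hom.at {S S' : NatSys.{u} A} (a : Hom S S') {n : SimplexCategory} (σ : S'.X.obj (op n)) :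
    S.T.obj (Simp.mk S.X (a.φ.app (op n) σ)) ⟶ S'.T.obj (Simp.mk S'.X σ) :=
  a.τ.app (Simp.mk S'.X σ)

/-- The morphism `∏ (σ : X_n), T σ ⟶ ∏ (σ : X'_n), T' σ`, `(a_σ)_σ ↦ (τ_σ (a_{φ σ}))_σ`. -/
def mapAt [HasProducts.{u} A] {S S' : NatSys.{u} A} (a : S ⟶ S') (n : SimplexCategory) :
    (∏ᶜ fun σ : S.X.obj (op n) ↦ S.T.obj (Simp.mk S.X σ)) ⟶
      ∏ᶜ fun σ : S'.X.obj (op n) ↦ S'.T.obj (Simp.mk S'.X σ) :=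
  Pi.lift fun σ : S'.X.obj (op n) ↦
    Pi.π (fun σ : S.X.obj (op n) ↦ S.T.obj (Simp.mk S.X σ)) (a.φ.app (op n) σ) ≫ Hom.at a σ

/-- The functoriality of the cosimplicial object. -/
def cosimplicialFunctor [HasProducts.{u} A] : NatSys.{u} A ⥤ CosimplicialObject A where
  obj S := S.cosimplicial
  map {S S'} a :=
    { app n := mapAt a n
      naturality m n θ := by
        refine Pi.hom_ext _ _ fun σ ↦ ?_
        have h : Hom.at a (S'.X.map θ.op σ) ≫ S'.T.map (Simp.homMk S'.X θ σ) =
            S.T.map ((simpMap a.φ).map (Simp.homMk S'.X θ σ)) ≫ Hom.at a σ :=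
          (a.τ.naturality (Simp.homMk S'.X θ σ)).symm
        simp only [mapAt, cosimplicial, Category.assoc, Pi.lift_π, Pi.lift_π_assoc, h]
        refine (Category.assoc _ _ _).symm.trans (Eq.trans ?_ (Category.assoc _ _ _))
        exact congrArg (· ≫ Hom.at a σ) (π_map_congr S (NatTrans.naturality_apply a.φ θ.op σ).symm
          (Simp.homMk S.X θ (a.φ.app (op n) σ)) ((simpMap a.φ).map (Simp.homMk S'.X θ σ)) rfl) }
  map_id S := by
    ext n : 2
    refine Pi.hom_ext _ _ fun σ ↦ ?_
    exact (Pi.lift_π _ _).trans ((Category.comp_id _).trans (Category.id_comp _).symm)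
  map_comp {S S' S''} a b := by
    ext n : 2
    change mapAt (a ≫ b) n = mapAt a n ≫ mapAt b n
    refine Pi.hom_ext _ _ fun σ ↦ ?_
    have h : Hom.at (a ≫ b) σ = Hom.at a (b.φ.app (op n) σ) ≫ Hom.at b σ := rfl
    simp only [mapAt, Category.assoc, Pi.lift_π, Pi.lift_π_assoc, h]
    rfl

/-- The Gabriel-Zisman cochain complex `C_GZ^*(X, T)`, with `C_GZ^n(X, T) = ∏ (σ : X_n), T σ` and
differential the alternating sum of the coface maps, as a functor in `(X, T)`. -/
def cochainComplex [Abelian A] [HasProducts.{u} A] : NatSys.{u} A ⥤ CochainComplex A ℕ :=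
  cosimplicialFunctor ⋙ AlgebraicTopology.alternatingCofaceMapComplex A

/-- The Gabriel-Zisman cohomology `H_GZ^n(X, T)`, as a functor in `(X, T)`. -/
def cohomology [Abelian A] [HasProducts.{u} A] (n : ℕ) : NatSys.{u} A ⥤ A :=
  cochainComplex ⋙ HomologicalComplex.homologyFunctor A _ n

end NatSys

/-! ### Pullback and pushforward of natural systems -/

variable (A)

/-- Restriction `(Δ/f)^*` of natural systems along `f : X ⟶ Y`. -/
abbrev restrict {X Y : SSet.{u}} (f : X ⟶ Y) : (Simp Y ⥤ A) ⥤ (Simp X ⥤ A) :=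
  (Functor.whiskeringLeft (Simp X) (Simp Y) A).obj (simpMap f)

variable [Abelian A] [HasLimitsOfSize.{u, u} A]

instance {X Y : SSet.{u}} (f : X ⟶ Y) (T : Simp X ⥤ A) :
    (simpMap f).HasRightKanExtension T := by
  have : HasLimitsOfSize.{0, u} A := hasLimitsOfSizeShrink.{0, u, u, u} A
  infer_instance

/-- The right Kan extension `(Δ/f)_* = Ran_{Δ/f}` of natural systems along `f : X ⟶ Y`. -/
abbrev pushforward {X Y : SSet.{u}} (f : X ⟶ Y) : (Simp X ⥤ A) ⥤ (Simp Y ⥤ A) :=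
  (simpMap f).ran

/-- The base change transformation `(Δ/ψ)^* (Δ/f)_* ⟶ (Δ/f')_* (Δ/φ)^*` of a commutative square
`φ ≫ f = f' ≫ ψ`: the mate of the identification `(Δ/f')^* (Δ/ψ)^* = (Δ/φ)^* (Δ/f)^*`. -/
def baseChange {X Y X' Y' : SSet.{u}} {f : X ⟶ Y} {f' : X' ⟶ Y'} {φ : X' ⟶ X} {ψ : Y' ⟶ Y}
    (h : φ ≫ f = f' ≫ ψ) :
    pushforward A f ⋙ restrict A ψ ⟶ restrict A φ ⋙ pushforward A f' :=
  (mateEquiv ((simpMap f).ranAdjunction A) ((simpMap f').ranAdjunction A)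
    (TwoSquare.mk _ _ _ _ (eqToHom (show restrict A ψ ⋙ restrict A f' =
      restrict A f ⋙ restrict A φ from congrArg (fun g ↦ restrict A g) h.symm)))).natTrans

variable {A}

/-- For a commutative square `φ ≫ f = f' ≫ ψ`, the extension of the base change transformation to
a morphism of connected sequences `(Δ/ψ)^* R^q(Δ/f)_* ⟶ R^q(Δ/f')_* (Δ/φ)^*`. -/
def IsSatelliteBaseChange {X Y X' Y' : SSet.{u}} {f : X ⟶ Y} {f' : X' ⟶ Y'} {φ : X' ⟶ X} {ψ : Y' ⟶ Y}
    (h : φ ≫ f = f' ≫ ψ) (R : RightSatellites (pushforward A f))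
    (R' : RightSatellites (pushforward A f'))
    (β : ConnectedSequence.Hom (R.seq.postcomp (restrict A ψ)) (R'.seq.precomp (restrict A φ))) :
    Prop :=
  β.app 0 ≫ Functor.whiskerLeft (restrict A φ) R'.zeroIso.hom =
    Functor.whiskerRight R.zeroIso.hom (restrict A ψ) ≫ baseChange A h

/-! ### The category of maps with a natural system on the source -/

variable (A) in
/-- A simplicial map `f : X ⟶ Y` with a natural system `T : Δ/X ⥤ A` on its source. -/
structure MapSys extends NatSys.{u} A where
  Y : SSet.{u}
  f : X ⟶ Y

namespace MapSys

/-- A morphism `(f, T) ⟶ (f', T')` consists of a commutative square `φ ≫ f = f' ≫ ψ` of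
simplicial maps `φ : X' ⟶ X`, `ψ : Y' ⟶ Y`, and a natural transformation `T ∘ Δ/φ ⟶ T'`. -/
@[ext]
structure Hom (S S' : MapSys.{u} A) where
  base : S.toNatSys ⟶ S'.toNatSys
  ψ : S'.Y ⟶ S.Y
  w : base.φ ≫ S.f = S'.f ≫ ψ

instance : Category (MapSys.{u} A) where
  Hom := Hom
  id S := { base := 𝟙 _, ψ := 𝟙 _, w := rfl }
  comp {S S' S''} a b :=
    { base := a.base ≫ b.base
      ψ := b.ψ ≫ a.ψ
      w := by
        change (b.base.φ ≫ a.base.φ) ≫ S.f = S''.f ≫ b.ψ ≫ a.ψ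
        rw [Category.assoc, a.w, ← Category.assoc, b.w, Category.assoc] }
  id_comp a := Hom.ext (Category.id_comp a.base) (Category.comp_id a.ψ)
  comp_id a := Hom.ext (Category.comp_id a.base) (Category.id_comp a.ψ)
  assoc a b c := Hom.ext (Category.assoc a.base b.base c.base) (Category.assoc c.ψ b.ψ a.ψ).symm

/-- The functor `(f : X ⟶ Y, T) ↦ (X, T)`. -/
def source : MapSys.{u} A ⥤ NatSys.{u} A where
  obj S := S.toNatSys
  map a := a.base

/-- The natural system `(Y, R^q(Δ/f)_* T)`. -/
def direct (S : MapSys.{u} A) (R : RightSatellites (pushforward A S.f)) (q : ℕ) : NatSys.{u} A where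
  X := S.Y
  T := (R.seq.obj q).obj S.T

/-- The morphism `(Y, R^q(Δ/f)_* T) ⟶ (Y', R^q(Δ/f')_* T')` induced by a morphism
`(f, T) ⟶ (f', T')`: the composition
`(Δ/ψ)^* R^q(Δ/f)_* T ⟶ R^q(Δ/f')_* (Δ/φ)^* T ⟶ R^q(Δ/f')_* T'`. -/
def directMap {S S' : MapSys.{u} A} (m : S ⟶ S') (R : RightSatellites (pushforward A S.f))
    (R' : RightSatellites (pushforward A S'.f))
    (β : ConnectedSequence.Hom (R.seq.postcomp (restrict A m.ψ))
      (R'.seq.precomp (restrict A m.base.φ))) (q : ℕ) :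
    S.direct R q ⟶ S'.direct R' q :=
  NatSys.Hom.mk (S := S.direct R q) (S' := S'.direct R' q) m.ψ
    ((β.app q).app S.T ≫ (R'.seq.obj q).map m.base.τ)

end MapSys

end GabrielZisman

end

open Homological GabrielZisman

/-!
For a map `f : X ⟶ Y` of simplicial sets the functor `Δ/f : Δ/X ⥤ Δ/Y` is a discrete fibration:
an arrow `y ⟶ f x` lifts uniquely to an arrow with target `x`. The right Kan extension `f_*` along
`Δ/f` is therefore the product over the fibres, `(f_* T)(y) = ∏ (x ∈ f⁻¹ y), T x`. If products are
exact, then so is `f_*`; hence its satellites vanish in positive degrees, every spectral sequence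
with `E₂^{p,q} ≅ H_GZ^p(Y, R^q f_* T)` lies in the row `q = 0`, and the edge morphism
`H_GZ^p(Y, f_* T) ⟶ H_GZ^p(X, T)` is an isomorphism, already on cochains.
-/

noncomputable section

namespace Homological

/-! ### Satellites of functors preserving epimorphisms -/

section Satellites

open ZeroObject

variable {C D E : Type*} [Category C] [Abelian C] [Category D] [Abelian D]
  [Category E] [Abelian E]

namespace ConnectedSequence

lemma comp_δ_zero {F : C ⥤ D} [F.PreservesEpimorphisms] (G : ConnectedSequence C D)
    (a : F ⟶ G.obj 0) (S : ShortComplex C) (hS : S.ShortExact) :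
    a.app S.X₃ ≫ G.δ 0 S hS = 0 := by
  have := hS.epi_g
  rw [← cancel_epi (F.map S.g), NatTrans.naturality_assoc, G.map_g_δ, comp_zero, comp_zero]

/-- The extension by zero of a natural transformation `F⁰ ⟶ G⁰`. It is a morphism of connected
sequences because `a ≫ δ⁰` is killed by the epimorphisms `F⁰ S.g`. -/
def Hom.extendByZero {F G : ConnectedSequence C D} [(F.obj 0).PreservesEpimorphisms]
    (a : F.obj 0 ⟶ G.obj 0) : Hom F G where
  app
    | 0 => a
    | _ + 1 => 0
  comm
    | 0, S, hS => comp_zero.trans (G.comp_δ_zero a S hS).symm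
    | _ + 1, _, _ => comp_zero.trans zero_comp.symm

theorem isUniversal_iff_isZero_succ (F : ConnectedSequence C D)
    [(F.obj 0).PreservesEpimorphisms] : F.IsUniversal ↔ ∀ n, IsZero (F.obj (n + 1)) := by
  refine ⟨fun hF n ↦ ?_, fun hF G a ↦ ⟨.extendByZero a, rfl, fun b hb ↦ ?_⟩⟩
  · have h : (⟨fun n ↦ 𝟙 _, by simp⟩ : Hom F F) = .extendByZero (𝟙 _) :=
      (hF F (𝟙 _)).unique rfl rfl
    exact (IsZero.iff_id_eq_zero _).2 (congrFun (congrArg Hom.app h) (n + 1))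
  · ext n : 2
    cases n with
    | zero => exact hb
    | succ n => exact (hF n).eq_of_src _ _

/-- The connected sequence `F, 0, 0, …`. -/
def ofFunctor (F : C ⥤ D) [F.Additive] : ConnectedSequence C D where
  obj
    | 0 => F
    | _ + 1 => 0
  additive
    | 0 => ‹_›
    | _ + 1 => inferInstanceAs (0 : C ⥤ D).Additive
  δ _ _ _ := 0
  map_g_δ _ _ _ := comp_zero
  δ_map_f _ _ _ := zero_comp
  δ_naturality _ _ _ _ _ _ := by rw [zero_comp, comp_zero]

end ConnectedSequence

namespace RightSatellites

variable {F : C ⥤ D} [F.PreservesEpimorphisms]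

variable (F) in
/-- The right satellites `F, 0, 0, …` of an additive functor preserving epimorphisms. -/
def ofPreservesEpimorphisms [F.Additive] : RightSatellites F where
  seq := .ofFunctor F
  zeroIso := .refl F
  isUniversal :=
    have : ((ConnectedSequence.ofFunctor F).obj 0).PreservesEpimorphisms := ‹_›
    (ConnectedSequence.isUniversal_iff_isZero_succ _).2 fun _ ↦ isZero_zero _

instance (R : RightSatellites F) : (R.seq.obj 0).PreservesEpimorphisms :=
  Functor.PreservesEpimorphisms.of_iso R.zeroIso.symm

lemma isZero_obj_succ (R : RightSatellites F) (n : ℕ) : IsZero (R.seq.obj (n + 1)) :=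
  (ConnectedSequence.isUniversal_iff_isZero_succ _).1 R.isUniversal n

lemma isUniversal_postcomp (R : RightSatellites F) (L : D ⥤ E) [L.Additive]
    [L.PreservesEpimorphisms] : (R.seq.postcomp L).IsUniversal := by
  have : ((R.seq.postcomp L).obj 0).PreservesEpimorphisms :=
    inferInstanceAs (R.seq.obj 0 ⋙ L).PreservesEpimorphisms
  refine (ConnectedSequence.isUniversal_iff_isZero_succ _).2 fun n ↦ Functor.isZero _ fun X ↦ ?_
  exact L.map_isZero ((R.isZero_obj_succ n).obj X)

end RightSatellites

end Satellites

/-! ### Spectral sequences concentrated in the row `q = 0` -/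

section Row

open ZeroObject

section StepFiltration

variable {C : Type*} [Category C] [HasZeroObject C] (X : C) {n p : ℕ}

/-- The terms of the decreasing filtration `X = F⁰ = ⋯ = Fⁿ ⊇ Fⁿ⁺¹ = 0` with one jump. -/
def stepFiltration (n p : ℕ) : C :=
  if p ≤ n then X else 0

namespace stepFiltration

lemma eq_of_le (h : p ≤ n) : stepFiltration X n p = X := if_pos h

lemma isZero_of_lt (h : n < p) : IsZero (stepFiltration X n p) := by
  rw [stepFiltration, if_neg h.not_ge]
  exact isZero_zero C

variable [HasZeroMorphisms C]

/-- The inclusion of `Fᵖ` in `X`. -/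
def ι (n p : ℕ) : stepFiltration X n p ⟶ X :=
  if h : p ≤ n then eqToHom (eq_of_le X h) else 0

lemma isIso_ι (h : p ≤ n) : IsIso (ι X n p) := by
  rw [ι, dif_pos h]
  infer_instance

instance (n p : ℕ) : Mono (ι X n p) := by
  obtain h | h := le_or_gt p n
  · have := isIso_ι X h
    infer_instance
  · exact (isZero_of_lt X h).mono _

/-- The inclusion of `Fᵖ⁺¹` in `Fᵖ`. -/
def incl (n p : ℕ) : stepFiltration X n (p + 1) ⟶ stepFiltration X n p :=
  if h : p + 1 ≤ n then eqToHom ((eq_of_le X h).trans (eq_of_le X (by lia)).symm) else 0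

lemma incl_ι (n p : ℕ) : incl X n p ≫ ι X n p = ι X n (p + 1) := by
  obtain h | h := le_or_gt (p + 1) n
  · rw [incl, ι, ι, dif_pos h, dif_pos h, dif_pos (by lia), eqToHom_trans]
  · exact (isZero_of_lt X h).eq_of_src _ _

lemma isIso_incl (h : p + 1 ≤ n) : IsIso (incl X n p) := by
  rw [incl, dif_pos h]
  infer_instance

end stepFiltration

end StepFiltration

section ZeroDifferential

variable {C : Type*} [Category C] [HasZeroMorphisms C] {κ : Type*} (c : ComplexShape κ)

/-- The complex with zero differentials on a graded object. -/
def zeroDifferential : (κ → C) ⥤ HomologicalComplex C c where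
  obj X := { X := X, d _ _ := 0 }
  map φ := { f := φ }

/-- A complex with zero differentials is its own homology. -/
def zeroDifferentialHomologyIso [CategoryWithHomology C] (k : κ) :
    zeroDifferential c ⋙ HomologicalComplex.homologyFunctor C c k ≅ Pi.eval (fun _ ↦ C) k :=
  NatIso.ofComponents
    (fun X ↦ (ShortComplex.LeftHomologyData.ofZeros
      (((zeroDifferential c).obj X).sc k) rfl rfl).homologyIso)
    fun φ ↦ (ShortComplex.LeftHomologyMapData.ofZeros
      ((HomologicalComplex.shortComplexFunctor C c k).map ((zeroDifferential c).map φ))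
      rfl rfl rfl rfl).homologyMap_comm

end ZeroDifferential

variable {J : Type*} [Category J] {A : Type v} [Category.{w} A] [Abelian A]

namespace Convergence

variable (E : J ⥤ E₂CohomologicalSpectralSequenceNat A) (H : ℕ → (J ⥤ A))
  (e : ∀ p, H p ≅ E ⋙ pageInfty A p 0)

/-- The projection of `Fᵖ` to `E_∞^{p,q}`, for `q = 0` the isomorphism `Fᵖ = H p ≅ E_∞^{p,0}`. -/
def rowProj (p q : ℕ) : stepFiltration (H (p + q)) (p + q) p ⟶ E ⋙ pageInfty A p q :=
  match q with
  | 0 => stepFiltration.ι (H p) p p ≫ (e p).hom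
  | _ + 1 => 0

/-- Convergence of a spectral sequence whose limit term is concentrated in the row `q = 0`: the
filtration of `H n ≅ E_∞^{n,0}` has only one jump. -/
def ofRow (hE : ∀ p q, IsZero (E ⋙ pageInfty A p (q + 1))) : Convergence E H where
  fil n p := stepFiltration (H n) n p
  ι n p := stepFiltration.ι (H n) n p
  mono_ι n p j := inferInstance
  incl n p := stepFiltration.incl (H n) n p
  incl_ι n p := stepFiltration.incl_ι (H n) n p
  isIso_ι_zero n j :=
    have := stepFiltration.isIso_ι (H n) (Nat.zero_le n)
    inferInstance
  isZero_fil n j := (stepFiltration.isZero_of_lt (H n) n.lt_succ_self).obj j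
  proj p q := rowProj E H e p q
  incl_proj p q j := by
    cases q with
    | zero => exact ((stepFiltration.isZero_of_lt (H p) p.lt_succ_self).obj j).eq_of_src _ _
    | succ q => exact comp_zero
  shortExact p q j := by
    cases q with
    | zero =>
      have := stepFiltration.isIso_ι (H p) (le_refl p)
      have : IsIso ((rowProj E H e p 0).app j) :=
        inferInstanceAs (IsIso ((stepFiltration.ι (H p) p p ≫ (e p).hom).app j))
      exact (ShortComplex.Splitting.ofIsZeroOfIsIso _
        ((stepFiltration.isZero_of_lt (H p) p.lt_succ_self).obj j) this).shortExact
    | succ q =>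
      have := stepFiltration.isIso_incl (H (p + (q + 1))) (n := p + (q + 1)) (p := p) (by lia)
      exact (ShortComplex.Splitting.ofIsIsoOfIsZero _ (inferInstanceAs
        (IsIso ((stepFiltration.incl (H (p + (q + 1))) (p + (q + 1)) p).app j)))
        ((hE p q).obj j)).shortExact

end Convergence

variable (H : ℕ → (J ⥤ A))

/-- The bigraded functor with `H p` in position `(p, 0)` and zero elsewhere. -/
def rowEntry (pq : ℕ × ℕ) : J ⥤ A :=
  match pq with
  | (p, 0) => H p
  | (_, _ + 1) => 0

/-- The family of spectral sequences with zero differentials whose pages have `H p` in position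
`(p, 0)` and zero elsewhere. -/
def rowSpectralSequence : J ⥤ E₂CohomologicalSpectralSequenceNat A where
  obj j :=
    { page r _ := (zeroDifferential _).obj fun pq ↦ (rowEntry H pq).obj j
      iso r r' pq _ _ := (zeroDifferentialHomologyIso _ pq).app _ }
  map f :=
    { hom r _ := (zeroDifferential _).map fun pq ↦ (rowEntry H pq).map f
      comm r r' pq _ _ := (zeroDifferentialHomologyIso _ pq).hom.naturality _ }
  map_id j := by
    ext r hr pq
    exact (rowEntry H pq).map_id j
  map_comp f g := by
    ext r hr pq
    exact (rowEntry H pq).map_comp f g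

/-- The convergence of `rowSpectralSequence H`, all of whose pages are equal, to `H`. -/
def rowConvergence : Convergence (rowSpectralSequence H) H :=
  .ofRow _ _ (fun p ↦ .refl (H p)) fun _ _ ↦ isZero_zero _

end Row

end Homological

namespace GabrielZisman

/-! ### Right Kan extensions along discrete fibrations -/

lemma initial_discreteFunctor {I J : Type*} [Category J] (s : I → J)
    (h : ∀ t, Nonempty (Unique (Σ i, s i ⟶ t))) : (Discrete.functor s).Initial where
  out t := by
    obtain ⟨_⟩ := h t
    let ofSigma (p : Σ i, s i ⟶ t) : CostructuredArrow (Discrete.functor s) t :=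
      .mk (Y := Discrete.mk p.1) p.2
    have : Nonempty (CostructuredArrow (Discrete.functor s) t) := ⟨ofSigma default⟩
    have : Subsingleton (CostructuredArrow (Discrete.functor s) t) :=
      Function.Surjective.subsingleton (f := ofSigma) fun x ↦ ⟨⟨x.left.as, x.hom⟩, x.eq_mk.symm⟩
    infer_instance

section Ran

variable {C D H : Type*} [Category C] [Category D] [Category H] (L : C ⥤ D)
  [∀ d, HasLimitsOfShape (StructuredArrow d L) H]

/-- The value of `L.ran` at `d` is the limit over the arrows from `d`, naturally in the functor. -/
def ranCompEvaluationIso (d : D) : L.ran ⋙ (evaluation D H).obj d ≅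
    (Functor.whiskeringLeft _ _ H).obj (StructuredArrow.proj d L) ⋙ lim :=
  NatIso.ofComponents (fun T ↦ L.ranObjObjIsoLimit T d) fun {T T'} τ ↦ by
    refine limit.hom_ext fun t ↦ ?_
    have h : (L.ran.map τ).app (L.obj t.right) ≫ (L.ranCounit.app T').app t.right =
        (L.ranCounit.app T).app t.right ≫ τ.app ((StructuredArrow.proj d L).obj t) :=
      NatTrans.congr_app (L.ranCounit.naturality τ) t.right
    simp only [Functor.comp_obj, evaluation_obj_obj, Functor.whiskeringLeft_obj_obj, lim_obj,
      Functor.comp_map, evaluation_obj_map, Category.assoc, Functor.ranObjObjIsoLimit_hom_π,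
      Functor.id_obj, Functor.whiskeringLeft_obj_map, lim_map, limMap_π, Functor.whiskerLeft_app,
      Functor.ranObjObjIsoLimit_hom_π_assoc]
    exact ((L.ran.map τ).naturality_assoc t.hom _).symm.trans (congrArg _ h)

lemma ran_preservesEpimorphisms [HasFiniteColimits H]
    [∀ d, HasExactLimitsOfShape (StructuredArrow d L) H] :
    (L.ran : (C ⥤ H) ⥤ (D ⥤ H)).PreservesEpimorphisms where
  preserves τ _ :=
    have (d : D) : Epi ((L.ran.map τ).app d) := by
      have := Functor.PreservesEpimorphisms.of_iso (ranCompEvaluationIso (H := H) L d).symm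
      exact inferInstanceAs (Epi ((L.ran ⋙ (evaluation D H).obj d).map τ))
    NatTrans.epi_of_epi_app _

end Ran

section Fibre

variable {C : Type*} [Category C] {F G : C ⥤ Type u} (α : F ⟶ G)

/-- The fibre of `F.Elementsᵒᵖ ⥤ G.Elementsᵒᵖ` over `y`, encoded by elements of `F`. -/
def Fibre (y : G.Elementsᵒᵖ) : Type u :=
  {x : F.obj y.unop.1 // α.app y.unop.1 x = y.unop.2}

namespace Fibre

variable {α} {y : G.Elementsᵒᵖ}

/-- An element of the fibre as an object of `F.Elementsᵒᵖ`. -/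
def elem (s : Fibre α y) : F.Elementsᵒᵖ := op (F.elementsMk y.unop.1 s.1)

/-- The identity of `y`, as an arrow from `y` to the image of `s`. -/
def arrow (s : Fibre α y) : StructuredArrow y (CategoryOfElements.map α).op :=
  .mk (Y := s.elem) (Quiver.Hom.op ⟨𝟙 y.unop.1,
    (ConcreteCategory.congr_hom (G.map_id y.unop.1) _).trans s.2⟩)

/-- The source of the unique lift of an arrow `y ⟶ α x` to an arrow with target `x`. -/
def lift (t : StructuredArrow y (CategoryOfElements.map α).op) : Fibre α y :=
  ⟨F.map t.hom.unop.1 t.right.unop.2, (NatTrans.naturality_apply α _ _).trans t.hom.unop.2⟩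

lemma nonempty_unique_arrow_hom (t : StructuredArrow y (CategoryOfElements.map α).op) :
    Nonempty (Unique (Σ s : Fibre α y, s.arrow ⟶ t)) := by
  refine ⟨⟨⟨lift t, StructuredArrow.homMk (Quiver.Hom.op ⟨t.hom.unop.1, rfl⟩) ?_⟩⟩, ?_⟩
  · exact Quiver.Hom.unop_inj (Subtype.ext (Category.comp_id _))
  · rintro ⟨s, a⟩
    have h : a.right.unop.1 = t.hom.unop.1 := by
      rw [← StructuredArrow.w a]
      exact (Category.comp_id _).symm
    obtain rfl : s = lift t := Subtype.ext (by
      refine a.right.unop.2.symm.trans ?_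
      rw [h]; rfl)
    congr 1
    exact StructuredArrow.hom_ext _ _ (Quiver.Hom.unop_inj (Subtype.ext h))

instance : (Discrete.functor (Fibre.arrow (α := α) (y := y))).Initial :=
  initial_discreteFunctor _ nonempty_unique_arrow_hom

end Fibre

variable (y : G.Elementsᵒᵖ) (A : Type*) [Category A] [HasProducts.{u} A]

instance : HasLimitsOfShape (StructuredArrow y (CategoryOfElements.map α).op) A :=
  Functor.Initial.hasLimitsOfShape_of_initial (Discrete.functor Fibre.arrow)

instance [AB4StarOfSize.{u} A] [HasFiniteColimits A] :
    HasExactLimitsOfShape (StructuredArrow y (CategoryOfElements.map α).op) A :=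
  hasExactLimitsOfShape_of_initial A (Discrete.functor Fibre.arrow)

variable {A} (T : F.Elementsᵒᵖ ⥤ A)

/-- The value at `y` of the right Kan extension of `T`, with its projections to the values of `T` on
the fibre over `y`. -/
def fibreFan : Fan fun s : Fibre α y ↦ T.obj s.elem :=
  Fan.mk (((CategoryOfElements.map α).op.ran.obj T).obj y) fun s ↦
    ((CategoryOfElements.map α).op.ran.obj T).map s.arrow.hom ≫
      ((CategoryOfElements.map α).op.ranCounit.app T).app s.elem

/-- The right Kan extension is the product over the fibres. -/
def isLimitFibreFan : IsLimit (fibreFan α y T) := by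
  have h := (Functor.Initial.isLimitWhiskerEquiv (Discrete.functor (Fibre.arrow (y := y))) _).symm
    ((CategoryOfElements.map α).op.isPointwiseRightKanExtensionRanCounit T y)
  let e : Discrete.functor (Fibre.arrow (y := y)) ⋙ StructuredArrow.proj y _ ⋙ T ≅
      Discrete.functor fun s : Fibre α y ↦ T.obj s.elem := Discrete.natIso fun _ ↦ .refl _
  refine .ofIsoLimit ((IsLimit.postcomposeHomEquiv e _).symm h) ?_
  exact Cone.ext (Iso.refl _) fun s ↦ (Category.comp_id _).trans (Category.id_comp _).symm

end Fibre

lemma isIso_piMap' {C : Type*} [Category C] {ι κ : Type*} {P : κ → C} {Q : ι → C} [HasProduct P]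
    [HasProduct Q] (g : ι → κ) (q : ∀ i, P (g i) ⟶ Q i)
    (p : ∀ k (s : {i // g i = k}), P k ⟶ Q s.1) (hp : ∀ i, p (g i) ⟨i, rfl⟩ = q i)
    (h : ∀ k, IsLimit (Fan.mk (P k) (p k))) : IsIso (Limits.Pi.map' g q) := by
  have hfac (k : κ) (s : {i // g i = k}) :
      (h k).lift (Fan.mk _ fun s ↦ Pi.π Q s.1) ≫ p k s = Pi.π Q s.1 := (h k).fac _ ⟨s⟩
  refine ⟨Pi.lift fun k ↦ (h k).lift (Fan.mk _ fun s ↦ Pi.π Q s.1), ?_, ?_⟩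
  · refine Pi.hom_ext _ _ fun k ↦ Fan.IsLimit.hom_ext (h k) _ _ ?_
    rintro ⟨i, rfl⟩
    simp [← hp, hfac]
  · refine Pi.hom_ext _ _ fun i ↦ ?_
    simp [← hp, hfac]

/-! ### Cohomology of the pushforward -/

variable {A : Type v} [Category.{w} A]

section Exactness

variable [Abelian A] [HasLimitsOfSize.{u, u} A] {X Y : SSet.{u}} (f : X ⟶ Y)

instance : (pushforward A f).Additive :=
  ((simpMap f).ranAdjunction A).right_adjoint_additive

instance [AB4StarOfSize.{u} A] : (pushforward A f).PreservesEpimorphisms :=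
  ran_preservesEpimorphisms _

end Exactness

namespace NatSys

lemma hom_ext {S S' : NatSys.{u} A} {a b : S ⟶ S'} (hφ : a.φ = b.φ)
    (hτ : ∀ x : Simp S'.X, a.τ.app x = S.T.map (eqToHom (by rw [hφ])) ≫ b.τ.app x) : a = b := by
  obtain ⟨φ, τ⟩ := a
  obtain ⟨φ', τ'⟩ := b
  obtain rfl : φ = φ' := hφ
  congr
  ext x
  exact (hτ x).trans ((congrArg (· ≫ τ'.app x) (S.T.map_id _)).trans (Category.id_comp _))

variable (A) in
/-- The inclusion of the natural systems on `X`, with morphisms over the identity of `X`. -/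
def inclusion (X : SSet.{u}) : (Simp X ⥤ A) ⥤ NatSys.{u} A where
  obj T := ⟨X, T⟩
  map τ := ⟨𝟙 X, τ⟩
  map_comp _ _ := Hom.ext (Category.id_comp _).symm (heq_of_eq rfl)

lemma isZero_cohomology [Abelian A] [HasProducts.{u} A] (S : NatSys.{u} A) (hS : IsZero S.T)
    (n : ℕ) : IsZero ((cohomology n).obj S) := by
  refine (ShortComplex.exact_iff_isZero_homology _).1 (ShortComplex.exact_of_isZero_X₂ _ ?_)
  suffices IsZero (∏ᶜ fun σ : S.X.obj (op ⦋n⦌) ↦ S.T.obj (Simp.mk S.X σ)) from this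
  rw [IsZero.iff_id_eq_zero]
  exact Pi.hom_ext _ _ fun σ ↦ (hS.obj _).eq_of_tgt _ _

section OfPushforward

variable [HasLimitsOfSize.{u, u} A] {X Y : SSet.{u}} (f : X ⟶ Y) (T : Simp X ⥤ A)

/-- The morphism `(Y, f_* T) ⟶ (X, T)` given by `f` and the counit `f^* f_* T ⟶ T`. -/
def ofPushforward : NatSys.mk Y ((pushforward A f).obj T) ⟶ NatSys.mk X T :=
  NatSys.Hom.mk (S := ⟨Y, (pushforward A f).obj T⟩) (S' := ⟨X, T⟩) f ((simpMap f).ranCounit.app T)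

instance (n : SimplexCategory) : IsIso (mapAt (ofPushforward f T) n) := by
  refine isIso_piMap' (P := fun y ↦ ((pushforward A f).obj T).obj (Simp.mk Y y))
    (Q := fun x ↦ T.obj (Simp.mk X x)) (f.app (op n)) (fun x ↦ (ofPushforward f T).at x)
    (fun y s ↦ (fibreFan f (Simp.mk Y y) T).proj s) (fun x ↦ ?_)
    fun y ↦ isLimitFibreFan f (Simp.mk Y y) T
  exact (congrArg (· ≫ _) (CategoryTheory.Functor.map_id _ _)).trans (Category.id_comp _)

instance : IsIso (cosimplicialFunctor.map (ofPushforward f T)) := by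
  have (n : SimplexCategory) : IsIso ((cosimplicialFunctor.map (ofPushforward f T)).app n) :=
    inferInstanceAs (IsIso (mapAt (ofPushforward f T) n))
  exact NatIso.isIso_of_isIso_app _

instance [Abelian A] (n : ℕ) : IsIso ((cohomology n).map (ofPushforward f T)) :=
  inferInstanceAs (IsIso ((AlgebraicTopology.alternatingCofaceMapComplex A ⋙
    HomologicalComplex.homologyFunctor A _ n).map (cosimplicialFunctor.map (ofPushforward f T))))

end OfPushforward

end NatSys

section BaseChange

lemma eqToHom_restrict_app_app {X Y : SSet.{u}} {g g' : X ⟶ Y} (h : g = g') (P : Simp Y ⥤ A)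
    (x : Simp X) :
    ((eqToHom (congrArg (fun g ↦ restrict A g) h)).app P).app x =
      P.map (eqToHom (by rw [h])) := by
  subst h
  exact (P.map_id _).symm

variable [HasLimitsOfSize.{u, u} A] {X Y X' Y' : SSet.{u}} {f : X ⟶ Y} {f' : X' ⟶ Y'}
  {φ : X' ⟶ X} {ψ : Y' ⟶ Y} (h : φ ≫ f = f' ≫ ψ)

lemma baseChange_comp_ranCounit (T : Simp X ⥤ A) (x : Simp X') :
    ((baseChange A h).app T).app ((simpMap f').obj x) ≫
        ((simpMap f').ranCounit.app ((restrict A φ).obj T)).app x =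
      ((pushforward A f).obj T).map (eqToHom (show (simpMap (f' ≫ ψ)).obj x =
        (simpMap (φ ≫ f)).obj x by rw [h])) ≫
        ((simpMap f).ranCounit.app T).app ((simpMap φ).obj x) := by
  have hcounit := NatTrans.congr_app (mateEquiv_counit ((simpMap f).ranAdjunction A)
    ((simpMap f').ranAdjunction A) (TwoSquare.mk _ _ _ _ (eqToHom (show
      restrict A ψ ⋙ restrict A f' = restrict A f ⋙ restrict A φ from
        congrArg (fun g ↦ restrict A g) h.symm))) T) x
  rw [Functor.ranAdjunction_counit, Functor.ranAdjunction_counit] at hcounit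
  exact hcounit.trans (congrArg (· ≫ ((simpMap f).ranCounit.app T).app ((simpMap φ).obj x))
    (eqToHom_restrict_app_app h.symm ((pushforward A f).obj T) x))

variable [Abelian A] [AB4StarOfSize.{u} A]

theorem existsUnique_isSatelliteBaseChange (R : RightSatellites (pushforward A f))
    (R' : RightSatellites (pushforward A f')) : ∃! β, IsSatelliteBaseChange h R R' β :=
  (existsUnique_congr fun _ ↦ (Functor.isoWhiskerLeft (restrict A φ) R'.zeroIso).eq_comp_inv).1
    (R.isUniversal_postcomp (restrict A ψ) (R'.seq.precomp (restrict A φ))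
      ((Functor.whiskerRight R.zeroIso.hom (restrict A ψ) ≫ baseChange A h) ≫
        Functor.whiskerLeft (restrict A φ) R'.zeroIso.inv))

end BaseChange

namespace MapSys

variable [HasLimitsOfSize.{u, u} A]

section Pushforward

variable {S S' : MapSys.{u} A} (m : S ⟶ S')

/-- The morphism `(Y, f_* T) ⟶ (Y', f'_* T')` induced by a morphism `(f, T) ⟶ (f', T')`: the
composition `(Δ/ψ)^* f_* T ⟶ f'_* (Δ/φ)^* T ⟶ f'_* T'`. -/
def pushforwardMap : NatSys.mk S.Y ((pushforward A S.f).obj S.T) ⟶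
    NatSys.mk S'.Y ((pushforward A S'.f).obj S'.T) :=
  NatSys.Hom.mk (S := ⟨S.Y, (pushforward A S.f).obj S.T⟩)
    (S' := ⟨S'.Y, (pushforward A S'.f).obj S'.T⟩) m.ψ
    ((baseChange A m.w).app S.T ≫ (pushforward A S'.f).map m.base.τ)

lemma pushforwardMap_comp_ofPushforward :
    pushforwardMap m ≫ NatSys.ofPushforward S'.f S'.T =
      NatSys.ofPushforward S.f S.T ≫ m.base := by
  refine NatSys.hom_ext m.w.symm fun x ↦ ?_
  have hτ := NatTrans.congr_app ((simpMap S'.f).ranCounit.naturality m.base.τ) x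
  exact ((CommSq.mk (baseChange_comp_ranCounit m.w S.T x)).horiz_comp ⟨hτ⟩).w

end Pushforward

variable [Abelian A]

section ZerothSatellite

variable (S : MapSys.{u} A) (R : RightSatellites (pushforward A S.f))

/-- The isomorphism `(Y, R⁰f_* T) ≅ (Y, f_* T)`. -/
def directZeroIso : S.direct R 0 ≅ NatSys.mk S.Y ((pushforward A S.f).obj S.T) :=
  (NatSys.inclusion A S.Y).mapIso (R.zeroIso.app S.T)

/-- The morphism `(Y, R⁰f_* T) ⟶ (X, T)` given by `f` and the counit `f^* f_* T ⟶ T`. -/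
def ofDirect : S.direct R 0 ⟶ S.toNatSys :=
  (S.directZeroIso R).hom ≫ NatSys.ofPushforward S.f S.T

end ZerothSatellite

section ZerothSatelliteNaturality

variable {S S' : MapSys.{u} A} (m : S ⟶ S')
  {R : RightSatellites (pushforward A S.f)} {R' : RightSatellites (pushforward A S'.f)}
  {β : ConnectedSequence.Hom (R.seq.postcomp (restrict A m.ψ))
    (R'.seq.precomp (restrict A m.base.φ))} (hβ : IsSatelliteBaseChange m.w R R' β)

include hβ

lemma directZeroIso_naturality :
    directMap m R R' β 0 ≫ (S'.directZeroIso R').hom =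
      (S.directZeroIso R).hom ≫ pushforwardMap m := by
  refine NatSys.Hom.ext ((Category.id_comp _).trans (Category.comp_id _).symm) (heq_of_eq ?_)
  have hβ₀ : (β.app 0).app S.T ≫ R'.zeroIso.hom.app ((restrict A m.base.φ).obj S.T) =
      (restrict A m.ψ).map (R.zeroIso.hom.app S.T) ≫ (baseChange A m.w).app S.T :=
    NatTrans.congr_app hβ S.T
  exact ((CommSq.mk hβ₀).horiz_comp ⟨R'.zeroIso.hom.naturality m.base.τ⟩).w

lemma directMap_comp_ofDirect :
    directMap m R R' β 0 ≫ S'.ofDirect R' = S.ofDirect R ≫ m.base := by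
  rw [ofDirect, reassoc_of% directZeroIso_naturality m hβ, pushforwardMap_comp_ofPushforward,
    ofDirect, Category.assoc]

end ZerothSatelliteNaturality

variable [HasProducts.{u} A]

section Leray

variable (S : MapSys.{u} A) (R : RightSatellites (pushforward A S.f))

instance (n : ℕ) : IsIso ((NatSys.cohomology n).map (S.ofDirect R)) := by
  rw [ofDirect, Functor.map_comp]
  infer_instance

/-- The edge isomorphism `H_GZ^p(X, T) ≅ H_GZ^p(Y, R⁰f_* T)`. -/
def cohomologyDirectIso (p : ℕ) :
    (NatSys.cohomology p).obj S.toNatSys ≅ (NatSys.cohomology p).obj (S.direct R 0) :=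
  (asIso ((NatSys.cohomology p).map (S.ofDirect R))).symm

/-- The Leray spectral sequence of `(f, T)`: its rows `q > 0` vanish, and every page has
`H_GZ^p(X, T)` in position `(p, 0)`. -/
abbrev leraySpectralSequence : MapSys.{u} A ⥤ E₂CohomologicalSpectralSequenceNat A :=
  rowSpectralSequence fun n ↦ source ⋙ NatSys.cohomology n

variable [AB4StarOfSize.{u} A]

lemma isZero_cohomology_direct_succ (p q : ℕ) :
    IsZero ((NatSys.cohomology p).obj (S.direct R (q + 1))) :=
  NatSys.isZero_cohomology _ ((R.isZero_obj_succ q).obj S.T) p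

/-- The isomorphism `E_r^{p,q} ≅ H_GZ^p(Y, R^q f_* T)`, for every page `r`. -/
def lerayPageIso (r : ℤ) (hr : 2 ≤ r) (p q : ℕ) :
    ((leraySpectralSequence.obj S).page r hr).X (p, q) ≅ (NatSys.cohomology p).obj (S.direct R q) :=
  match q with
  | 0 => S.cohomologyDirectIso R p
  | q + 1 => ((isZero_zero (MapSys.{u} A ⥤ A)).obj S).iso (S.isZero_cohomology_direct_succ R p q)

end Leray

variable {S S' : MapSys.{u} A} (m : S ⟶ S')
  {R : RightSatellites (pushforward A S.f)} {R' : RightSatellites (pushforward A S'.f)}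
  {β : ConnectedSequence.Hom (R.seq.postcomp (restrict A m.ψ))
    (R'.seq.precomp (restrict A m.base.φ))} (hβ : IsSatelliteBaseChange m.w R R' β)

include hβ

lemma cohomologyDirectIso_naturality (p : ℕ) :
    (NatSys.cohomology p).map m.base ≫ (S'.cohomologyDirectIso R' p).hom =
      (S.cohomologyDirectIso R p).hom ≫ (NatSys.cohomology p).map (directMap m R R' β 0) := by
  refine (IsIso.comp_inv_eq _).2 ((IsIso.eq_inv_comp _).2 ?_ |>.trans (Category.assoc _ _ _).symm)
  rw [← Functor.map_comp, ← Functor.map_comp, directMap_comp_ofDirect m hβ]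

lemma lerayPageIso_naturality [AB4StarOfSize.{u} A] (r : ℤ) (hr : 2 ≤ r) (p q : ℕ) :
    ((leraySpectralSequence.map m).hom r hr).f (p, q) ≫ (S'.lerayPageIso R' r hr p q).hom =
      (S.lerayPageIso R r hr p q).hom ≫ (NatSys.cohomology p).map (directMap m R R' β q) := by
  cases q with
  | zero => exact cohomologyDirectIso_naturality m hβ p
  | succ q => exact (S'.isZero_cohomology_direct_succ R' p q).eq_of_tgt _ _

end MapSys

end GabrielZisman

end

theorem mainTheorem1 (A : Type v) [Category.{w} A] [Abelian A] [HasLimitsOfSize.{u, u} A]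
    [AB4StarOfSize.{u} A] :
    (∀ ⦃X Y : SSet.{u}⦄ (f : X ⟶ Y), Nonempty (RightSatellites (pushforward A f))) ∧
    ∀ R : (∀ ⦃X Y : SSet.{u}⦄ (f : X ⟶ Y), RightSatellites (pushforward A f)),
      (∀ ⦃X Y X' Y' : SSet.{u}⦄ (f : X ⟶ Y) (f' : X' ⟶ Y') (φ : X' ⟶ X) (ψ : Y' ⟶ Y)
        (h : φ ≫ f = f' ≫ ψ), ∃! β, IsSatelliteBaseChange h (R f) (R f') β) ∧
      ∃ E : MapSys.{u} A ⥤ E₂CohomologicalSpectralSequenceNat A,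
        Nonempty (Convergence E (fun n ↦ MapSys.source ⋙ NatSys.cohomology n)) ∧
        ∃ e : ∀ (S : MapSys.{u} A) (p q : ℕ),
            ((E.obj S).page 2).X (p, q) ≅ (NatSys.cohomology p).obj (S.direct (R S.f) q),
          ∀ ⦃S S' : MapSys.{u} A⦄ (m : S ⟶ S') (β), IsSatelliteBaseChange m.w (R S.f) (R S'.f) β →
            ∀ p q : ℕ, ((E.map m).hom 2).f (p, q) ≫ (e S' p q).hom =
              (e S p q).hom ≫
                (NatSys.cohomology p).map (MapSys.directMap m (R S.f) (R S'.f) β q) :=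
  ⟨fun _ _ _ ↦ ⟨.ofPreservesEpimorphisms _⟩, fun R ↦
    ⟨fun _ _ _ _ _ _ _ _ h ↦ existsUnique_isSatelliteBaseChange h _ _,
      MapSys.leraySpectralSequence, ⟨rowConvergence _⟩, fun S ↦ S.lerayPageIso (R S.f) 2 le_rfl,
      fun _ _ m _ hβ ↦ MapSys.lerayPageIso_naturality m hβ 2 le_rfl⟩⟩
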